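/- Let $L\ge 1$ and $T\ge 0$ be integers and let $\epsilon>0$. Let $\mathcal A_{\mathrm{tree}}$ be the set of the $2^L-1$ nodes of the complete binary tree with $L$ levels. For a path $\mathbf p$ from the root to a leaf let $f^{(\mathbf p)}:\mathcal A_{\mathrm{tree}}\to\mathbb R$ be equal to $1$ at the leaf of $\mathbf p$, to $1-2\epsilon$ at the other nodes of $\mathbf p$, and to $1-12\epsilon$ at all nodes outside $\mathbf p$, and let $\mathcal F_{\mathrm{tree}}$ be the set of all these functions. A learning algorithm with $T$ rounds of sampling (without contexts) draws in round $t=1,\dots,T$ an action $a_t\sim\pi_t$, observes $r_t=f(a_t)+\xi_t$, where $\xi_t\sim\mathcal N(0,1)$ conditionally on everything before it, and at the end returns a probability distribution $\widehat\pi_T$ on $\mathcal A_{\mathrm{tree}}$ which may depend on all the data and on the internal randomness of the algorithm. It is adaptive if $\pi_t$ may depend on the internal randomness and on $(a_s,r_s)_{s<t}$; it is a (static) planning algorithm if the policies $\pi_1,\dots,\pi_T$ are determined by the internal randomness alone, independently of the data observed during the sampling. $\mathbb E_{\mathrm{Alg},f}$ denotes the expectation over the randomness of the algorithm and of the environment with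 mean reward function $f$. (1) If $L\ge 2$ and $T\le \frac{2^{L-5}}{9\epsilon^2}$, then for every planning algorithm $\mathrm{Alg}$ there is a function $f_\star\in\mathcal F_{\mathrm{tree}}$ such that $$\mathbb E_{\mathrm{Alg},f_\star}\left[\mathbb E_{a\sim\widehat\pi_T}[f_\star(a)]\right]<\max_{a\in\mathcal A_{\mathrm{tree}}}f_\star(a)-\epsilon .$$ (2) If $\epsilon\le 1$ and $T\ge\frac{2L\log(2L/\epsilon)}{\epsilon^2}$, then there is an adaptive algorithm $\mathrm{Alg}_{\mathrm{adaptive}}$ such that for all $f\in\mathcal F_{\mathrm{tree}}$ $$\mathbb E_{\mathrm{Alg}_{\mathrm{adaptive}},f}\left[\mathbb E_{a\sim\widehat\pi_T}[f(a)]\right]\ge\max_{a\in\mathcal A_{\mathrm{tree}}}f(a)-\epsilon .$$ -/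

import Mathlib

open MeasureTheory ProbabilityTheory

universe u

/-- The actions `a_{l,i}`: the nodes of the complete binary tree with `L` levels (levels and the
positions inside a level are numbered from `0`, so level `l` has `2 ^ l` nodes, the root is the
unique node of level `0`, and the leaves are the nodes of level `L - 1`). -/
abbrev TreeNode (L : ℕ) : Type := Σ l : Fin L, Fin (2 ^ (l : ℕ))

instance (L : ℕ) : DiscreteMeasurableSpace (TreeNode L) where
  forall_measurableSet _ := MeasurableSpace.measurableSet_iInf.2 fun _ => MeasurableSet.of_discrete (α := Fin _)

/-- A path from the root to a leaf: one node in each level, each node being a child of the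
previous one. The children of node `i` of level `l` are the nodes `2 i` and `2 i + 1` of
level `l + 1`. -/
structure TreePath (L : ℕ) where
  /-- position of the node of the path in level `l` -/
  idx : (l : Fin L) → Fin (2 ^ (l : ℕ))
  /-- consecutive nodes are parent and child -/
  child : ∀ l m : Fin L, (m : ℕ) = (l : ℕ) + 1 →
    (idx m : ℕ) = 2 * (idx l : ℕ) ∨ (idx m : ℕ) = 2 * (idx l : ℕ) + 1

/-- The node `a` lies on the path `p`. -/
def TreePath.Mem {L : ℕ} (p : TreePath L) (a : TreeNode L) : Prop := a.2 = p.idx a.1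

/-- The node `a` is a leaf. -/
def TreeNode.IsLeaf {L : ℕ} (a : TreeNode L) : Prop := (a.1 : ℕ) + 1 = L

open Classical in
/-- The mean reward function `f^{(p)}`: `1` at the leaf of `p`, `1 - 2 ε` at the other nodes
of `p`, and `1 - 12 ε` off `p`. -/
noncomputable def treeFun {L : ℕ} (ε : ℝ) (p : TreePath L) (a : TreeNode L) : ℝ :=
  if p.Mem a then (if TreeNode.IsLeaf a then 1 else 1 - 2 * ε) else 1 - 12 * ε

/-- The function class `F_tree`. -/
def treeClass (L : ℕ) (ε : ℝ) : Set (TreeNode L → ℝ) :=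
  Set.range (treeFun ε : TreePath L → TreeNode L → ℝ)

/-- The action-reward pairs observed in the first `t` rounds. -/
abbrev History (A : Type) (t : ℕ) : Type := Fin t → A × ℝ

/-- A (possibly randomized and adaptive) learning algorithm with `T` rounds of sampling.
Before the first round it draws its internal randomness `s` (the seed). In round `t` it draws an
action from a distribution that may depend on `s` and on everything observed in the rounds
before, and after `T` rounds it returns a distribution over the actions, its final policy, that
may depend on `s` and on all the data. (Only the policies with index `t < T` are ever used.) -/
structure LearningAlgorithm (A : Type) [MeasurableSpace A] (T : ℕ) where
  /-- the values of the internal randomness -/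
  Seed : Type u
  [seedSpace : MeasurableSpace Seed]
  /-- the law of the internal randomness -/
  seedLaw : Measure Seed
  [seedLaw_prob : IsProbabilityMeasure seedLaw]
  /-- the sampling policy of each round -/
  policy : (t : ℕ) → Kernel (Seed × History A t) A
  [policy_markov : ∀ t, IsMarkovKernel (policy t)]
  /-- the final policy -/
  finalPolicy : Kernel (Seed × History A T) A
  [finalPolicy_markov : IsMarkovKernel finalPolicy]

namespace LearningAlgorithm

attribute [instance] seedSpace seedLaw_prob policy_markov finalPolicy_markov

variable {A : Type} [MeasurableSpace A] {T : ℕ}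

/-- A (static) planning algorithm: its sampling policies are a function of its internal
randomness alone, so that the whole policy sequence is fixed before the sampling starts and no
policy depends on the data observed during the sampling. The final policy may use all data. -/
def IsPlanning (alg : LearningAlgorithm.{u} A T) : Prop :=
  ∀ t < T, ∀ (s : alg.Seed) (h h' : History A t), alg.policy t (s, h) = alg.policy t (s, h')

end LearningAlgorithm

/-- Given the chosen action `a`, the reward is `f a + ξ` with `ξ` standard Gaussian, that is,
it has the law `N(f a, 1)`. -/
noncomputable def rewardKernel {A : Type} [MeasurableSpace A] [Countable A]
    [DiscreteMeasurableSpace A] (f : A → ℝ) : Kernel A ℝ where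
  toFun a := gaussianReal (f a) 1
  measurable' := Measurable.of_discrete

instance {A : Type} [MeasurableSpace A] [Countable A] [DiscreteMeasurableSpace A] (f : A → ℝ) :
    IsMarkovKernel (rewardKernel f) :=
  ⟨fun a => inferInstanceAs (IsProbabilityMeasure (gaussianReal (f a) 1))⟩

/-- Appends the action and the reward of the new round to the data. -/
def extendData {S A : Type*} {t : ℕ} (x : ((S × (Fin t → A × ℝ)) × A) × ℝ) :
    S × (Fin (t + 1) → A × ℝ) :=
  (x.1.1.1, Fin.snoc (α := fun _ => A × ℝ) x.1.1.2 (x.1.2, x.2))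

theorem measurable_extendData {S A : Type*} [MeasurableSpace S] [MeasurableSpace A] {t : ℕ} :
    Measurable (extendData : ((S × (Fin t → A × ℝ)) × A) × ℝ → S × (Fin (t + 1) → A × ℝ)) := by
  unfold extendData
  refine Measurable.prodMk (by fun_prop) (measurable_pi_iff.2 fun i => ?_)
  refine Fin.lastCases ?_ (fun j => ?_) i
  · simp only [Fin.snoc_last]; fun_prop
  · simp only [Fin.snoc_castSucc]; fun_prop

namespace LearningAlgorithm

variable {A : Type} [MeasurableSpace A] [Countable A] [DiscreteMeasurableSpace A] {T : ℕ}

/-- The joint law of the internal randomness and of the data of the first `t` rounds when the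
algorithm interacts with the environment whose mean reward function is `f`. -/
noncomputable def dataLaw (alg : LearningAlgorithm.{u} A T) (f : A → ℝ) :
    (t : ℕ) → Measure (alg.Seed × History A t)
  | 0 => alg.seedLaw.map fun s => (s, Fin.elim0)
  | t + 1 => ((alg.dataLaw f t ⊗ₘ alg.policy t) ⊗ₘ
      (rewardKernel f).comap Prod.snd measurable_snd).map extendData

instance isProbabilityMeasure_dataLaw (alg : LearningAlgorithm.{u} A T) (f : A → ℝ) (t : ℕ) :
    IsProbabilityMeasure (alg.dataLaw f t) := by
  induction t with
  | zero => exact Measure.isProbabilityMeasure_map (by fun_prop)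
  | succ t ih => exact Measure.isProbabilityMeasure_map measurable_extendData.aemeasurable

/-- `E_{Alg, f} [ E_{a ∼ π̂_T} [ f a ] ]`: the expected mean reward of the final policy, over the
randomness of the algorithm and of the environment with mean reward function `f`. -/
noncomputable def expectedValue (alg : LearningAlgorithm.{u} A T) (f : A → ℝ) : ℝ :=
  ∫ x, (∫ a, f a ∂(alg.finalPolicy x)) ∂(alg.dataLaw f T)

end LearningAlgorithm

/-! (1) A static plan cannot concentrate its samples below the unknown path. Among the `2 ^ (L - 2)`
pairs of sibling leaves, some pair receives at most `T / 2 ^ (L - 2)` expected samples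
(`exists_leafPair`). The two reward functions ending at these siblings differ only there, by `12 ε`,
so the Hellinger affinity of the two data laws is at least `1 - (12 ε) ^ 2 / 8 * T / 2 ^ (L - 2) ≥ 3
/ 4`. No action is good for both functions, and Cauchy-Schwarz (`IsPlanning.sq_lintegral_prod_le`)
turns this into a lower bound on the product of the two expected losses, which excludes that both
are at most `ε`.

(2) An adaptive algorithm descends from the root, testing at each level whether the left child lies
on the path by comparing the mean of `n` rewards with `1 - 7 ε`. Each test errs with probability at
most `exp (-25 ε ^ 2 n / 2)`. The union bound over the levels is carried by a supermartingale,
`searchPotential`. A miss costs at most `12 ε`, so failure probability `1 / 12` suffices. -/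

/-! ### Cauchy-Schwarz and the Hellinger affinity of Gaussians -/

/-- A form of the Cauchy-Schwarz inequality for nonnegative functions. -/
theorem sq_lintegral_le_lintegral_mul_lintegral {α : Type*} [MeasurableSpace α] {μ : Measure α}
    {g₁ g₂ w : α → ENNReal} (h₁ : Measurable g₁) (h₂ : Measurable g₂)
    (hw : ∀ x, w x ^ 2 ≤ g₁ x * g₂ x) :
    (∫⁻ x, w x ∂μ) ^ 2 ≤ (∫⁻ x, g₁ x ∂μ) * ∫⁻ x, g₂ x ∂μ := by
  have sqrt_le : ∀ x, w x ≤ g₁ x ^ (1 / 2 : ℝ) * g₂ x ^ (1 / 2 : ℝ) := fun x => by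
    rw [← ENNReal.mul_rpow_of_nonneg _ _ (by norm_num), one_div,
      ENNReal.le_rpow_inv_iff (by norm_num)]
    exact_mod_cast hw x
  have key := (lintegral_mono sqrt_le).trans (ENNReal.lintegral_mul_norm_pow_le (μ := μ)
    h₁.aemeasurable h₂.aemeasurable (p := 1 / 2) (q := 1 / 2) (by norm_num) (by norm_num)
    (by norm_num))
  rw [← ENNReal.mul_rpow_of_nonneg _ _ (by norm_num), one_div,
    ENNReal.le_rpow_inv_iff (by norm_num)] at key
  exact_mod_cast key

/-- Completing the square at the midpoint of the means: the geometric mean of the densities is a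
Gaussian density times their affinity. -/
theorem gaussianPDFReal_mul_gaussianPDFReal (m₁ m₂ x : ℝ) :
    gaussianPDFReal m₁ 1 x * gaussianPDFReal m₂ 1 x =
      (Real.exp (-(m₁ - m₂) ^ 2 / 8) * gaussianPDFReal ((m₁ + m₂) / 2) 1 x) ^ 2 := by
  simp only [gaussianPDFReal, NNReal.coe_one, mul_one]
  have h : Real.exp (-(x - m₁) ^ 2 / 2) * Real.exp (-(x - m₂) ^ 2 / 2) =
      (Real.exp (-(m₁ - m₂) ^ 2 / 8) * Real.exp (-(x - (m₁ + m₂) / 2) ^ 2 / 2)) ^ 2 := by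
    rw [← Real.exp_add, ← Real.exp_add, ← Real.exp_nat_mul]
    congr 1
    push_cast
    ring
  linear_combination (√(2 * Real.pi))⁻¹ ^ 2 * h

/-- If the product of two nonnegative functions is at least `c ^ 2`, so is the product of their
integrals against two unit Gaussians, up to the squared Hellinger affinity. -/
theorem sq_mul_exp_le_lintegral_gaussianReal_mul {g₁ g₂ : ℝ → ENNReal} (h₁ : Measurable g₁)
    (h₂ : Measurable g₂) {c : ENNReal} (hc : ∀ x, c ^ 2 ≤ g₁ x * g₂ x) (m₁ m₂ : ℝ) :
    (c * ENNReal.ofReal (Real.exp (-(m₁ - m₂) ^ 2 / 8))) ^ 2 ≤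
      (∫⁻ x, g₁ x ∂gaussianReal m₁ 1) * ∫⁻ x, g₂ x ∂gaussianReal m₂ 1 := by
  rw [gaussianReal_of_var_ne_zero _ one_ne_zero, gaussianReal_of_var_ne_zero _ one_ne_zero,
    lintegral_withDensity_eq_lintegral_mul _ (measurable_gaussianPDF _ _) h₁,
    lintegral_withDensity_eq_lintegral_mul _ (measurable_gaussianPDF _ _) h₂]
  have key := sq_lintegral_le_lintegral_mul_lintegral (μ := (volume : Measure ℝ))
    (w := fun x => (c * ENNReal.ofReal (Real.exp (-(m₁ - m₂) ^ 2 / 8))) *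
      gaussianPDF ((m₁ + m₂) / 2) 1 x)
    ((measurable_gaussianPDF m₁ 1).mul h₁) ((measurable_gaussianPDF m₂ 1).mul h₂) fun x => by
      have hp : gaussianPDF m₁ 1 x * gaussianPDF m₂ 1 x =
          (ENNReal.ofReal (Real.exp (-(m₁ - m₂) ^ 2 / 8)) *
            gaussianPDF ((m₁ + m₂) / 2) 1 x) ^ 2 := by
        simp only [gaussianPDF]
        rw [← ENNReal.ofReal_mul (gaussianPDFReal_nonneg _ _ _),
          gaussianPDFReal_mul_gaussianPDFReal, ← ENNReal.ofReal_mul (Real.exp_nonneg _),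
          ENNReal.ofReal_pow (by positivity [gaussianPDFReal_nonneg ((m₁ + m₂) / 2) 1 x])]
      calc _ = c ^ 2 * (gaussianPDF m₁ 1 x * gaussianPDF m₂ 1 x) := by rw [hp]; ring
        _ ≤ (g₁ x * g₂ x) * (gaussianPDF m₁ 1 x * gaussianPDF m₂ 1 x) := by gcongr; exact hc x
        _ = _ := by simp only [Pi.mul_apply]; ring
  rwa [lintegral_const_mul _ (measurable_gaussianPDF _ _),
    lintegral_gaussianPDF_eq_one _ one_ne_zero, mul_one] at key

/-- The Weierstrass inequality `1 - ∏ β ≤ ∑ (1 - β)`, kept free of the truncated subtraction of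
`ENNReal`. -/
theorem one_le_prod_add_sum {ι : Type*} (s : Finset ι) {β x : ι → ENNReal} (hβ : ∀ i, β i ≤ 1)
    (h : ∀ i, 1 ≤ β i + x i) : 1 ≤ ∏ i ∈ s, β i + ∑ i ∈ s, x i := by
  classical
  induction s using Finset.induction_on with
  | empty => simp
  | insert i s hi ih =>
    rw [Finset.prod_insert hi, Finset.sum_insert hi]
    have hp : ∏ i ∈ s, β i ≤ 1 := Finset.prod_le_one' fun i _ => hβ i
    calc 1 ≤ ∏ i ∈ s, β i + ∑ i ∈ s, x i := ih
      _ ≤ (β i + x i) * ∏ i ∈ s, β i + ∑ i ∈ s, x i := by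
        gcongr
        exact le_mul_of_one_le_left' (h i)
      _ = β i * ∏ i ∈ s, β i + x i * ∏ i ∈ s, β i + ∑ i ∈ s, x i := by rw [add_mul]
      _ ≤ β i * ∏ i ∈ s, β i + x i * 1 + ∑ i ∈ s, x i := by gcongr
      _ = _ := by rw [mul_one, add_assoc]

theorem measurable_extend {S A : Type*} [MeasurableSpace S] [MeasurableSpace A] (t : ℕ) :
    Measurable fun y : ((S × (Fin t → A × ℝ)) × A) × ℝ =>
      ((y.1.1.1, Fin.snoc (α := fun _ => A × ℝ) y.1.1.2 (y.1.2, y.2)) : S × (Fin (t + 1) → A × ℝ)) :=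
  measurable_extendData

/-! ### Affinity of the data laws of a planning algorithm -/

namespace LearningAlgorithm

variable {A : Type} [MeasurableSpace A] [Countable A] [DiscreteMeasurableSpace A] {T : ℕ}

theorem lintegral_dataLaw_succ (alg : LearningAlgorithm.{u} A T) (f : A → ℝ) (t : ℕ)
    {g : alg.Seed × History A (t + 1) → ENNReal} (hg : Measurable g) :
    ∫⁻ x, g x ∂alg.dataLaw f (t + 1) =
      ∫⁻ x, ∫⁻ a, ∫⁻ r, g (x.1, Fin.snoc (α := fun _ => A × ℝ) x.2 (a, r))
        ∂gaussianReal (f a) 1 ∂alg.policy t x ∂alg.dataLaw f t := by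
  have hg' := hg.comp (measurable_extendData (S := alg.Seed) (A := A) (t := t))
  simp only [Function.comp_def] at hg'
  rw [dataLaw, lintegral_map hg measurable_extendData, Measure.lintegral_compProd hg',
    Measure.lintegral_compProd hg'.lintegral_kernel_prod_right']
  rfl

theorem measurable_lintegral_reward {S : Type*} [MeasurableSpace S] (f : A → ℝ) (t : ℕ)
    {g : S × History A (t + 1) → ENNReal} (hg : Measurable g) :
    Measurable fun z : (S × History A t) × A =>
      ∫⁻ r, g (z.1.1, Fin.snoc (α := fun _ => A × ℝ) z.1.2 (z.2, r)) ∂gaussianReal (f z.2) 1 :=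
  (hg.comp (measurable_extendData (S := S) (A := A) (t := t))).lintegral_kernel_prod_right'
    (κ := (rewardKernel f).comap Prod.snd measurable_snd)

/-- The data of a planning algorithm under two reward functions: the Hellinger affinity of the
two laws is at least the product of the affinities of the rounds. -/
theorem IsPlanning.sq_lintegral_prod_le (alg : LearningAlgorithm.{u} A T) (hp : alg.IsPlanning)
    (d : A) (f₁ f₂ : A → ℝ) (t : ℕ) (ht : t ≤ T) (g₁ g₂ : alg.Seed × History A t → ENNReal)
    (hg₁ : Measurable g₁) (hg₂ : Measurable g₂) (c : alg.Seed → ENNReal)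
    (hc : ∀ x, c x.1 ^ 2 ≤ g₁ x * g₂ x) :
    (∫⁻ s, c s * ∏ τ ∈ Finset.range t, ∫⁻ a, ENNReal.ofReal (Real.exp (-(f₁ a - f₂ a) ^ 2 / 8))
        ∂alg.policy τ (s, fun _ => (d, 0)) ∂alg.seedLaw) ^ 2 ≤
      (∫⁻ x, g₁ x ∂alg.dataLaw f₁ t) * ∫⁻ x, g₂ x ∂alg.dataLaw f₂ t := by
  induction t generalizing c with
  | zero =>
    have hm : Measurable fun s : alg.Seed => (s, (Fin.elim0 : History A 0)) := by fun_prop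
    rw [dataLaw, dataLaw, lintegral_map hg₁ hm, lintegral_map hg₂ hm]
    refine sq_lintegral_le_lintegral_mul_lintegral (hg₁.comp hm) (hg₂.comp hm) fun s => ?_
    simpa using hc (s, Fin.elim0)
  | succ t ih =>
    have m₁ := measurable_lintegral_reward f₁ t hg₁
    have m₂ := measurable_lintegral_reward f₂ t hg₂
    rw [lintegral_dataLaw_succ alg f₁ t hg₁, lintegral_dataLaw_succ alg f₂ t hg₂]
    -- The last round is integrated out and its affinity absorbed into `c`; this is possible because
    -- for a planning algorithm that affinity is a function of the seed alone.
    refine le_of_eq_of_le ?_ (ih (by omega) _ _ (m₁.lintegral_kernel_prod_right')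
      (m₂.lintegral_kernel_prod_right')
      (fun s => c s * ∫⁻ a, ENNReal.ofReal (Real.exp (-(f₁ a - f₂ a) ^ 2 / 8))
        ∂alg.policy t (s, fun _ => (d, 0))) fun x => ?_)
    · simp only [Finset.prod_range_succ]
      congr 2
      funext s
      ring
    · rw [hp t (by omega) x.1 (fun _ => (d, 0)) x.2,
        ← lintegral_const_mul _ Measurable.of_discrete]
      refine sq_lintegral_le_lintegral_mul_lintegral (Measurable.of_discrete)
        (Measurable.of_discrete) fun a => ?_
      have hs : Measurable fun r : ℝ => ((x, a), r) := by fun_prop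
      exact sq_mul_exp_le_lintegral_gaussianReal_mul
        ((hg₁.comp (measurable_extend t)).comp hs) ((hg₂.comp (measurable_extend t)).comp hs)
        (fun r => hc (x.1, _)) _ _

/-- Expresses an affine function of the value as a lower integral, the form in which both the
affinity inequality and the supermartingale bound are stated. -/
theorem lintegral_ofReal_finalPolicy [Finite A] (alg : LearningAlgorithm.{u} A T) (f : A → ℝ)
    (α β : ℝ) (h : ∀ a, 0 ≤ α + β * f a) :
    ∫⁻ x, ∫⁻ a, ENNReal.ofReal (α + β * f a) ∂alg.finalPolicy x ∂alg.dataLaw f T =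
      ENNReal.ofReal (α + β * alg.expectedValue f) := by
  have hf : Integrable (fun z : (alg.Seed × History A T) × A => f z.2)
      (alg.dataLaw f T ⊗ₘ alg.finalPolicy) := by
    obtain ⟨C, hC⟩ := (Set.finite_range fun a => ‖f a‖).bddAbove
    refine Integrable.of_bound (C := C) ?_ (ae_of_all _ fun z => hC ⟨z.2, rfl⟩)
    exact ((Measurable.of_discrete (f := f)).comp measurable_snd).aestronglyMeasurable
  have hE : alg.expectedValue f = ∫ z, f z.2 ∂(alg.dataLaw f T ⊗ₘ alg.finalPolicy) :=
    (Measure.integral_compProd hf).symm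
  have hα : α + β * alg.expectedValue f =
      ∫ z, (α + β * f z.2) ∂(alg.dataLaw f T ⊗ₘ alg.finalPolicy) := by
    rw [hE, integral_add (integrable_const _) (hf.const_mul β), integral_const_mul,
      integral_const, probReal_univ, one_smul]
  have hi : Integrable (fun z : (alg.Seed × History A T) × A => α + β * f z.2)
      (alg.dataLaw f T ⊗ₘ alg.finalPolicy) := (integrable_const _).add (hf.const_mul β)
  rw [hα, ofReal_integral_eq_lintegral_ofReal hi (ae_of_all _ fun z => h z.2),
    Measure.lintegral_compProd]
  exact (Measurable.of_discrete (f := fun a => ENNReal.ofReal (α + β * f a))).comp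
      measurable_snd

end LearningAlgorithm

/-! ### Reward functions of sibling leaves -/

theorem treeFun_le_one {L : ℕ} {ε : ℝ} (hε : 0 < ε) (p : TreePath L) (a : TreeNode L) :
    treeFun ε p a ≤ 1 := by
  unfold treeFun
  split_ifs <;> linarith

theorem one_sub_le_treeFun {L : ℕ} {ε : ℝ} (hε : 0 < ε) (p : TreePath L) (a : TreeNode L) :
    1 - 12 * ε ≤ treeFun ε p a := by
  unfold treeFun
  split_ifs <;> linarith

theorem iSup_treeFun {L : ℕ} (hL : 1 ≤ L) {ε : ℝ} (hε : 0 < ε) (p : TreePath L) :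
    ⨆ a, treeFun ε p a = 1 := by
  let a : TreeNode L := ⟨⟨L - 1, by omega⟩, p.idx ⟨L - 1, by omega⟩⟩
  have : Nonempty (TreeNode L) := ⟨a⟩
  refine le_antisymm (ciSup_le (treeFun_le_one hε p)) ?_
  refine le_ciSup_of_le ⟨1, Set.forall_mem_range.2 (treeFun_le_one hε p)⟩ a (le_of_eq ?_)
  have h₁ : p.Mem a := rfl
  have h₂ : TreeNode.IsLeaf a := show L - 1 + 1 = L by omega
  simp [treeFun, h₁, h₂]

/-- The path to the leaf with position `j`. -/
def leafPath (L j : ℕ) (hj : j < 2 ^ (L - 1)) : TreePath L where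
  -- The ancestor in level `l` is found by dropping the last `L - 1 - l` binary digits of `j`.
  idx l := ⟨j / 2 ^ (L - 1 - l), by
    rw [Nat.div_lt_iff_lt_mul (by positivity), ← pow_add]
    rwa [show (l : ℕ) + (L - 1 - l) = L - 1 by omega]⟩
  child l m h := by
    have h₁ : L - 1 - (l : ℕ) = (L - 1 - m) + 1 := by omega
    simp only [h₁, pow_succ, ← Nat.div_div_eq_div_mul]
    omega

/-- The leaf with position `j`. -/
def leafNode (L j : ℕ) (hL : 1 ≤ L) (hj : j < 2 ^ (L - 1)) : TreeNode L :=
  ⟨⟨L - 1, by omega⟩, ⟨j, hj⟩⟩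

theorem isLeaf_leafNode {L j : ℕ} (hL : 1 ≤ L) (hj : j < 2 ^ (L - 1)) :
    (leafNode L j hL hj).IsLeaf := show L - 1 + 1 = L by omega

theorem mem_leafPath_leafNode {L j k : ℕ} (hL : 1 ≤ L) (hj : j < 2 ^ (L - 1))
    (hk : k < 2 ^ (L - 1)) : (leafPath L j hj).Mem (leafNode L k hL hk) ↔ k = j := by
  simp [TreePath.Mem, leafNode, leafPath, Fin.ext_iff]

theorem mem_leafPath_siblings {L i : ℕ} (h₀ : 2 * i < 2 ^ (L - 1)) (h₁ : 2 * i + 1 < 2 ^ (L - 1))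
    {a : TreeNode L} (ha : ¬ a.IsLeaf) :
    (leafPath L (2 * i) h₀).Mem a ↔ (leafPath L (2 * i + 1) h₁).Mem a := by
  have h : L - 1 - (a.1 : ℕ) = 1 + (L - 2 - a.1) := by
    have := a.1.2
    unfold TreeNode.IsLeaf at ha
    omega
  have hd : 2 * i / 2 ^ (L - 1 - (a.1 : ℕ)) = (2 * i + 1) / 2 ^ (L - 1 - (a.1 : ℕ)) := by
    rw [h, pow_add, ← Nat.div_div_eq_div_mul, ← Nat.div_div_eq_div_mul, pow_one]
    congr 1
    omega
  simp only [TreePath.Mem, leafPath, Fin.ext_iff, hd]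

theorem eq_leafNode {L : ℕ} (hL : 1 ≤ L) {a : TreeNode L} (ha : a.IsLeaf) :
    ∃ (k : ℕ) (hk : k < 2 ^ (L - 1)), a = leafNode L k hL hk := by
  obtain ⟨⟨l, hl⟩, ⟨k, hk⟩⟩ := a
  obtain rfl : l = L - 1 := by
    have : l + 1 = L := ha
    omega
  exact ⟨k, hk, rfl⟩

/-- The reward functions of two sibling leaves differ at these two leaves only. -/
theorem treeFun_siblings {L i : ℕ} (hL : 1 ≤ L) (h₀ : 2 * i < 2 ^ (L - 1))
    (h₁ : 2 * i + 1 < 2 ^ (L - 1)) {ε : ℝ} (hε : 0 < ε) (a : TreeNode L) :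
    (a = leafNode L (2 * i) hL h₀ ∧ treeFun ε (leafPath L (2 * i) h₀) a = 1 ∧
      treeFun ε (leafPath L (2 * i + 1) h₁) a = 1 - 12 * ε) ∨
    (a = leafNode L (2 * i + 1) hL h₁ ∧ treeFun ε (leafPath L (2 * i) h₀) a = 1 - 12 * ε ∧
      treeFun ε (leafPath L (2 * i + 1) h₁) a = 1) ∨
    (treeFun ε (leafPath L (2 * i) h₀) a = treeFun ε (leafPath L (2 * i + 1) h₁) a ∧
      treeFun ε (leafPath L (2 * i) h₀) a ≤ 1 - 2 * ε) := by
  by_cases ha : a.IsLeaf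
  · obtain ⟨k, hk, rfl⟩ := eq_leafNode hL ha
    simp only [treeFun, mem_leafPath_leafNode, ha, if_true]
    by_cases hk₀ : k = 2 * i
    · subst hk₀
      left
      simp
    by_cases hk₁ : k = 2 * i + 1
    · subst hk₁
      right; left
      simp
    right; right
    simp only [hk₀, hk₁, if_false, true_and]
    linarith
  · right; right
    simp only [treeFun, ha, if_false]
    classical
    refine ⟨if_congr (mem_leafPath_siblings h₀ h₁ ha) rfl rfl, ?_⟩
    split_ifs <;> linarith

/-- The pair of leaves below the node `i` of the last but one level. -/
def leafPair (L i : ℕ) : Set (TreeNode L) := {a | a.IsLeaf ∧ (a.2 : ℕ) / 2 = i}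

/-! ### The lower bound for planning algorithms -/

namespace LearningAlgorithm

variable {A : Type} [MeasurableSpace A] [DiscreteMeasurableSpace A] {T : ℕ}

theorem measurable_policy_const (alg : LearningAlgorithm.{u} A T) (d : A) (τ : ℕ)
    (g : A → ENNReal) :
    Measurable fun s : alg.Seed => ∫⁻ a, g a ∂alg.policy τ (s, fun _ => (d, 0)) :=
  (Measurable.of_discrete (f := g)).lintegral_kernel.comp
    (measurable_id.prodMk measurable_const :
      Measurable fun s : alg.Seed => (s, (fun _ => (d, 0) : History A τ)))

/-- The affinity of the action-reward data is close to `1` if the set `B`, where the two reward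
functions differ, is rarely sampled. -/
theorem one_le_lintegral_prod_add_sum (alg : LearningAlgorithm.{u} A T)
    (d : A) (f₁ f₂ : A → ℝ) (K : ℝ) (B : Set A) (hB : ∀ a ∉ B, f₁ a = f₂ a)
    (hK : ∀ a, (f₁ a - f₂ a) ^ 2 / 8 ≤ K) :
    1 ≤ (∫⁻ s, ∏ τ ∈ Finset.range T, ∫⁻ a, ENNReal.ofReal (Real.exp (-(f₁ a - f₂ a) ^ 2 / 8))
        ∂alg.policy τ (s, fun _ => (d, 0)) ∂alg.seedLaw) +
      ENNReal.ofReal K * ∑ τ ∈ Finset.range T,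
        ∫⁻ s, alg.policy τ (s, fun _ => (d, 0)) B ∂alg.seedLaw := by
  have hBm : MeasurableSet B := MeasurableSet.of_discrete
  have hm : ∀ τ, Measurable fun s : alg.Seed => alg.policy τ (s, fun _ => (d, 0)) B := by
    intro τ
    simpa [lintegral_indicator hBm] using
      alg.measurable_policy_const d τ (B.indicator fun _ => 1)
  rw [← lintegral_finsetSum _ fun τ _ => hm τ,
    ← lintegral_const_mul _ (Finset.measurable_fun_sum _ fun τ _ => hm τ),
    ← lintegral_add_left (Finset.measurable_fun_prod _ fun τ _ =>
      alg.measurable_policy_const d τ _)]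
  rw [← measure_univ (μ := alg.seedLaw), ← lintegral_one]
  refine lintegral_mono fun s => ?_
  rw [Finset.mul_sum]
  have hexp : ∀ a, ENNReal.ofReal (Real.exp (-(f₁ a - f₂ a) ^ 2 / 8)) ≤ 1 := fun a => by
    rw [ENNReal.ofReal_le_one, Real.exp_le_one_iff]
    nlinarith [sq_nonneg (f₁ a - f₂ a)]
  refine one_le_prod_add_sum _ (fun τ => ?_) fun τ => ?_
  · exact (lintegral_mono hexp).trans (by simp)
  · rw [← lintegral_indicator_const hBm, ← lintegral_add_left Measurable.of_discrete,
      ← measure_univ (μ := alg.policy τ (s, fun _ => (d, 0))), ← lintegral_one]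
    refine lintegral_mono fun a => ?_
    by_cases ha : a ∈ B
    · rw [Set.indicator_of_mem ha, ← ENNReal.ofReal_one, ← ENNReal.ofReal_add (Real.exp_nonneg _)
        ((by positivity : (0 : ℝ) ≤ (f₁ a - f₂ a) ^ 2 / 8).trans (hK a))]
      -- On `B` the bound is `1 - u ≤ exp (-u)`; off `B` the affinity is exactly `1`.
      refine ENNReal.ofReal_le_ofReal ?_
      have := Real.add_one_le_exp (-(f₁ a - f₂ a) ^ 2 / 8)
      linarith [hK a]
    · simp [hB a ha]

/-- Some pair of sibling leaves is sampled at most an average number of times. -/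
theorem exists_leafPair {L : ℕ} (alg : LearningAlgorithm.{u} (TreeNode L) T) (d : TreeNode L)
    (N : ℕ) (hN : 0 < N) : ∃ i < N, ∑ τ ∈ Finset.range T,
      ∫⁻ s, alg.policy τ (s, fun _ => (d, 0)) (leafPair L i) ∂alg.seedLaw ≤
        (T : ENNReal) / N := by
  by_contra! h
  have hm : ∀ τ (B : Set (TreeNode L)),
      Measurable fun s : alg.Seed => alg.policy τ (s, fun _ => (d, 0)) B := by
    intro τ B
    simpa [lintegral_indicator (MeasurableSet.of_discrete : MeasurableSet B)] using
      alg.measurable_policy_const d τ (B.indicator fun _ => 1)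
  have hlt := ENNReal.sum_lt_sum_of_nonempty (s := Finset.range N) ⟨0, by simpa using hN⟩
    (fun i hi => h i (Finset.mem_range.1 hi))
  rw [Finset.sum_const, Finset.card_range, nsmul_eq_mul,
    ENNReal.mul_div_cancel (by exact_mod_cast hN.ne') (ENNReal.natCast_ne_top N),
    Finset.sum_comm] at hlt
  refine hlt.not_ge ?_
  calc _ ≤ ∑ τ ∈ Finset.range T, (1 : ENNReal) := Finset.sum_le_sum fun τ _ => ?_
    _ = T := by simp
  rw [← lintegral_finsetSum _ fun i _ => hm τ _]
  calc _ ≤ ∫⁻ s, (1 : ENNReal) ∂alg.seedLaw := lintegral_mono fun s => ?_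
    _ = 1 := by simp
  -- The pairs are disjoint, so one round spends total mass at most `1` on them.
  rw [← measure_univ (μ := alg.policy τ (s, fun _ => (d, 0)))]
  refine sum_measure_le_measure_univ
    (fun i _ => (MeasurableSet.of_discrete : MeasurableSet (leafPair L i)).nullMeasurableSet) ?_
  intro i _ j _ hij
  refine Disjoint.aedisjoint (Set.disjoint_left.2 fun a ha hb => hij ?_)
  exact ha.2.symm.trans hb.2

theorem IsPlanning.exists_expectedValue_lt {L : ℕ} (hL : 2 ≤ L) {ε : ℝ} (hε : 0 < ε)
    (hT : (T : ℝ) ≤ (2 : ℝ) ^ ((L : ℤ) - 5) / (9 * ε ^ 2))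
    (alg : LearningAlgorithm.{u} (TreeNode L) T) (hp : alg.IsPlanning) :
    ∃ p : TreePath L, alg.expectedValue (treeFun ε p) < 1 - ε := by
  have hL₁ : 1 ≤ L := by omega
  obtain ⟨i, hi, hs⟩ := alg.exists_leafPair (leafNode L 0 hL₁ (by positivity)) (2 ^ (L - 2))
    (by positivity)
  have hpow : 2 ^ (L - 1) = 2 * 2 ^ (L - 2) := by
    rw [← pow_succ']
    congr 1
    omega
  have h₀ : 2 * i < 2 ^ (L - 1) := by omega
  have h₁ : 2 * i + 1 < 2 ^ (L - 1) := by omega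
  by_contra! hcon
  have hsib := treeFun_siblings hL₁ h₀ h₁ hε
  have c₁ := hcon (leafPath L _ h₀)
  have c₂ := hcon (leafPath L _ h₁)
  have le₁ := treeFun_le_one hε (leafPath L _ h₀)
  have le₂ := treeFun_le_one hε (leafPath L _ h₁)
  set f₁ := treeFun ε (leafPath L _ h₀)
  set f₂ := treeFun ε (leafPath L _ h₁)
  have hone := alg.one_le_lintegral_prod_add_sum (leafNode L 0 hL₁ (by positivity)) f₁ f₂
    (18 * ε ^ 2) (leafPair L i)
    (fun a ha => by
      rcases hsib a with h | h | h
      · exact absurd ⟨by rw [h.1]; exact isLeaf_leafNode _ _, by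
          rw [h.1]; simp only [leafNode]; omega⟩ ha
      · exact absurd ⟨by rw [h.1]; exact isLeaf_leafNode _ _, by
          rw [h.1]; simp only [leafNode]; omega⟩ ha
      · exact h.1)
    (fun a => by
      rcases hsib a with h | h | h
      · rw [h.2.1, h.2.2]; linarith
      · rw [h.2.1, h.2.2]; linarith
      · rw [h.1]; simp; positivity)
  -- Here `18 ε ^ 2 = (12 ε) ^ 2 / 8`, and the hypothesis on `T` reads `T / 2 ^ (L - 2) ≤ 1 / (72 ε
  -- ^ 2)`.
  have hbud : ENNReal.ofReal (18 * ε ^ 2) * ((T : ENNReal) / (2 ^ (L - 2) : ℕ)) ≤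
      ENNReal.ofReal (1 / 4) := by
    rw [← ENNReal.ofReal_natCast, ← ENNReal.ofReal_natCast,
      ← ENNReal.ofReal_div_of_pos (by positivity), ← ENNReal.ofReal_mul (by positivity)]
    refine ENNReal.ofReal_le_ofReal ?_
    have hz : (2 : ℝ) ^ ((L : ℤ) - 5) = 2 ^ (L - 2) / 8 := by
      rw [show (L : ℤ) - 5 = ((L - 2 : ℕ) : ℤ) - 3 by omega, zpow_sub₀ (by norm_num), zpow_natCast]
      norm_num
    rw [hz, le_div_iff₀ (by positivity)] at hT
    push_cast
    rw [← mul_div_assoc, div_le_iff₀ (by positivity)]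
    linarith
  -- The test functions are the losses `(1 - f) / ε + 1 / 2`. At either sibling their product is `(1
  -- / 2) * (25 / 2) = (5 / 2) ^ 2`; elsewhere both are at least `2 + 1 / 2`. The shift `1 / 2`
  -- keeps the product positive where one loss vanishes.
  have hkey := hp.sq_lintegral_prod_le alg (leafNode L 0 hL₁ (by positivity)) f₁ f₂ T le_rfl
    (fun x => ∫⁻ a, ENNReal.ofReal ((1 / ε + 1 / 2) + (-1 / ε) * f₁ a) ∂alg.finalPolicy x)
    (fun x => ∫⁻ a, ENNReal.ofReal ((1 / ε + 1 / 2) + (-1 / ε) * f₂ a) ∂alg.finalPolicy x)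
    (Measurable.of_discrete.lintegral_kernel) (Measurable.of_discrete.lintegral_kernel)
    (fun _ => ENNReal.ofReal (5 / 2)) (fun x => by
      have hcs := sq_lintegral_le_lintegral_mul_lintegral (μ := alg.finalPolicy x)
        (g₁ := fun a => ENNReal.ofReal ((1 / ε + 1 / 2) + (-1 / ε) * f₁ a))
        (g₂ := fun a => ENNReal.ofReal ((1 / ε + 1 / 2) + (-1 / ε) * f₂ a))
        (w := fun _ => ENNReal.ofReal (5 / 2))
        Measurable.of_discrete Measurable.of_discrete (fun a => by
          rw [← ENNReal.ofReal_pow (by norm_num)]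
          rcases hsib a with h | h | h
          · rw [h.2.1, h.2.2, ← ENNReal.ofReal_mul (by field_simp; linarith)]
            refine ENNReal.ofReal_le_ofReal (le_of_eq ?_)
            field_simp
            ring
          · rw [h.2.1, h.2.2, ← ENNReal.ofReal_mul (by field_simp; ring_nf; positivity)]
            refine ENNReal.ofReal_le_ofReal (le_of_eq ?_)
            field_simp
            ring
          · have h5 : 5 / 2 ≤ (1 / ε + 1 / 2) + (-1 / ε) * f₁ a := by
              have : 2 ≤ (1 - f₁ a) / ε := by rw [le_div_iff₀ hε]; linarith [h.2]
              calc _ = 2 + (1 / 2 : ℝ) := by norm_num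
                _ ≤ (1 - f₁ a) / ε + 1 / 2 := by linarith
                _ = _ := by ring
            rw [← h.1, ← ENNReal.ofReal_mul (by linarith)]
            refine ENNReal.ofReal_le_ofReal ?_
            nlinarith)
      simpa using hcs)
  have hnn : ∀ (f : TreeNode L → ℝ), (∀ a, f a ≤ 1) →
      ∀ a, 0 ≤ (1 / ε + 1 / 2) + (-1 / ε) * f a := fun f hf a => by
    have : 0 ≤ (1 - f a) / ε := div_nonneg (by linarith [hf a]) hε.le
    calc (0 : ℝ) ≤ (1 - f a) / ε + 1 / 2 := by linarith
      _ = _ := by ring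
  rw [alg.lintegral_ofReal_finalPolicy f₁ _ _ (hnn _ le₁),
    alg.lintegral_ofReal_finalPolicy f₂ _ _ (hnn _ le₂),
    lintegral_const_mul' _ _ ENNReal.ofReal_ne_top] at hkey
  have hup : ∀ v : ℝ, 1 - ε ≤ v → ENNReal.ofReal ((1 / ε + 1 / 2) + (-1 / ε) * v) ≤
      ENNReal.ofReal (3 / 2) := fun v hv => ENNReal.ofReal_le_ofReal <| by
    have : (1 - v) / ε ≤ 1 := by rw [div_le_iff₀ hε]; linarith
    calc _ = (1 - v) / ε + 1 / 2 := by ring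
      _ ≤ _ := by linarith
  have hlow : ENNReal.ofReal (3 / 4) ≤ ∫⁻ s, ∏ τ ∈ Finset.range T,
      ∫⁻ a, ENNReal.ofReal (Real.exp (-(f₁ a - f₂ a) ^ 2 / 8))
        ∂alg.policy τ (s, fun _ => (leafNode L 0 hL₁ (by positivity), 0)) ∂alg.seedLaw := by
    have := hone.trans (add_le_add_right ((mul_le_mul_right hs _).trans hbud) _)
    rw [show (1 : ENNReal) = ENNReal.ofReal (3 / 4) + ENNReal.ofReal (1 / 4) by
      rw [← ENNReal.ofReal_add (by norm_num) (by norm_num)]; norm_num] at this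
    exact (ENNReal.add_le_add_iff_right ENNReal.ofReal_ne_top).1 this
  have hfin := (pow_le_pow_left' (mul_le_mul_right hlow _) 2).trans
    (hkey.trans (mul_le_mul' (hup _ c₁) (hup _ c₂)))
  rw [← ENNReal.ofReal_mul (by norm_num), ← ENNReal.ofReal_pow (by norm_num),
    ← ENNReal.ofReal_mul (by norm_num), ENNReal.ofReal_le_ofReal_iff (by norm_num)] at hfin
  -- The contradiction is `(5 / 2 * 3 / 4) ^ 2 ≤ (3 / 2) ^ 2`, that is, `15 / 8 ≤ 3 / 2`.
  norm_num at hfin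

end LearningAlgorithm

/-! ### The adaptive search -/

/-- The Chernoff factor contributed by a single reward centred at `c`. -/
theorem lintegral_exp_gaussianReal (m c s : ℝ) :
    ∫⁻ r, ENNReal.ofReal (Real.exp (s * (r - c))) ∂gaussianReal m 1 =
      ENNReal.ofReal (Real.exp (s * (m - c) + s ^ 2 / 2)) := by
  have h : ∀ r, Real.exp (s * (r - c)) = Real.exp (-(s * c)) * Real.exp (s * r) := fun r => by
    rw [← Real.exp_add]
    congr 1
    ring
  have hm : ∫ r, Real.exp (s * r) ∂gaussianReal m 1 = Real.exp (m * s + s ^ 2 / 2) := by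
    simpa [mgf] using mgf_gaussianReal (p := gaussianReal m 1) (X := id) (Measure.map_id) s
  simp_rw [h]
  rw [← ofReal_integral_eq_lintegral_ofReal
    ((integrable_exp_mul_gaussianReal s).const_mul _) (ae_of_all _ fun r => by positivity),
    integral_const_mul, hm, ← Real.exp_add]
  congr 2
  ring

namespace TreePath

variable {L : ℕ} (p : TreePath L)

/-- The position in level `l` of the node of the path, and `0` if there is no level `l`. -/
def pos (l : ℕ) : ℕ := if h : l < L then p.idx ⟨l, h⟩ else 0

theorem pos_lt {l : ℕ} (h : l < L) : p.pos l < 2 ^ l := by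
  simp only [pos, h, dif_pos]
  exact (p.idx ⟨l, h⟩).2

theorem pos_zero : p.pos 0 = 0 := by
  by_cases h : 0 < L
  · have := p.pos_lt h
    omega
  · simp [pos, h]

theorem pos_succ {l : ℕ} (h : l + 1 < L) :
    p.pos (l + 1) = 2 * p.pos l ∨ p.pos (l + 1) = 2 * p.pos l + 1 := by
  have h' : l < L := by omega
  simp only [pos, h, h', dif_pos]
  exact p.child ⟨l, h'⟩ ⟨l + 1, h⟩ rfl

end TreePath

/-- The node with position `i` in level `l`, and the root if there is no such node. -/
def toNode {L : ℕ} (hL : 1 ≤ L) (l i : ℕ) : TreeNode L :=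
  if h : l < L ∧ i < 2 ^ l then ⟨⟨l, h.1⟩, ⟨i, h.2⟩⟩ else ⟨⟨0, hL⟩, ⟨0, by simp⟩⟩

theorem mem_toNode {L : ℕ} (hL : 1 ≤ L) (p : TreePath L) {l i : ℕ} (hl : l < L) (hi : i < 2 ^ l) :
    p.Mem (toNode hL l i) ↔ i = p.pos l := by
  rw [toNode, dif_pos ⟨hl, hi⟩, TreePath.Mem, TreePath.pos, dif_pos hl, Fin.ext_iff]

theorem isLeaf_toNode {L : ℕ} (hL : 1 ≤ L) {l i : ℕ} (hl : l + 1 = L) (hi : i < 2 ^ l) :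
    (toNode hL l i).IsLeaf := by
  have h : l < L := by omega
  simpa [toNode, h, hi, TreeNode.IsLeaf] using hl

/-- The state `((l, k, i), S)` of the search: the current node is node `i` of level `l`, its left
child has been sampled `k` times, and `S` is the sum of the rewards, centred at `1 - 7 ε`. -/
abbrev SearchState : Type := (ℕ × ℕ × ℕ) × ℝ

/-- The update of the state by a reward `r`: after `n` samples the search moves to a child. -/
noncomputable def searchStep (L n : ℕ) (ε : ℝ) (σ : SearchState) (r : ℝ) : SearchState :=
  if σ.1.1 + 1 < L then
    if σ.1.2.1 + 1 < n then ((σ.1.1, σ.1.2.1 + 1, σ.1.2.2), σ.2 + (r - (1 - 7 * ε)))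
    -- The threshold is midway between `1 - 2 ε` and `1 - 12 ε`; a positive sum speaks for the left
    -- child.
    else if 0 < σ.2 + (r - (1 - 7 * ε)) then ((σ.1.1 + 1, 0, 2 * σ.1.2.2), 0)
    else ((σ.1.1 + 1, 0, 2 * σ.1.2.2 + 1), 0)
  else σ

theorem measurable_searchStep (L n : ℕ) (ε : ℝ) :
    Measurable fun x : SearchState × ℝ => searchStep L n ε x.1 x.2 := by
  unfold searchStep
  refine Measurable.ite (measurableSet_lt (by fun_prop) (by fun_prop)) (Measurable.ite
    (measurableSet_lt (by fun_prop) (by fun_prop)) (by fun_prop) (Measurable.ite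
    (measurableSet_lt (by fun_prop) (by fun_prop)) (by fun_prop) (by fun_prop))) (by fun_prop)

/-- The state of the search after the rewards of a history. -/
noncomputable def searchState {A : Type} (L n : ℕ) (ε : ℝ) :
    (t : ℕ) → History A t → SearchState
  | 0, _ => ((0, 0, 0), 0)
  | t + 1, h => searchStep L n ε (searchState L n ε t (Fin.init h)) (h (Fin.last t)).2

theorem measurable_searchState {A : Type} [MeasurableSpace A] (L n : ℕ) (ε : ℝ) (t : ℕ) :
    Measurable (searchState L n ε t : History A t → SearchState) := by
  induction t with
  | zero => exact measurable_const
  | succ t ih =>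
    have hi : Measurable fun h : History A (t + 1) => (Fin.init h : History A t) :=
      measurable_pi_iff.2 fun i => measurable_pi_apply _
    exact (measurable_searchStep L n ε).comp ((ih.comp hi).prodMk (by fun_prop))

theorem searchState_snoc {A : Type} (L n : ℕ) (ε : ℝ) (t : ℕ) (h : History A t) (x : A × ℝ) :
    searchState L n ε (t + 1) (Fin.snoc (α := fun _ => A × ℝ) h x) =
      searchStep L n ε (searchState L n ε t h) x.2 := by
  simp [searchState, Fin.init_snoc]

/-- The last clause is a clock: each level takes exactly `n` rounds. It holds only above the leaves,
where the state is not yet frozen. -/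
theorem searchState_invariant {A : Type} {L n : ℕ} (hL : 1 ≤ L) (hn : 1 ≤ n) (ε : ℝ) (t : ℕ)
    (h : History A t) :
    (searchState L n ε t h).1.2.1 < n ∧ (searchState L n ε t h).1.1 < L ∧
      (searchState L n ε t h).1.2.2 < 2 ^ (searchState L n ε t h).1.1 ∧
      ((searchState L n ε t h).1.1 + 1 < L →
        (searchState L n ε t h).1.1 * n + (searchState L n ε t h).1.2.1 = t) := by
  induction t with
  | zero => exact ⟨hn, hL, by simp [searchState], by simp [searchState]⟩
  | succ t ih =>
    obtain ⟨h₁, h₂, h₃, h₄⟩ := ih (Fin.init h)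
    simp only [searchState]
    generalize searchState L n ε t (Fin.init h) = σ at *
    unfold searchStep
    split_ifs with c₁ c₂ c₃
    · exact ⟨c₂, h₂, h₃, fun _ => by have := h₄ c₁; simp only; omega⟩
    · refine ⟨hn, c₁, by simp only [pow_succ]; omega, fun _ => ?_⟩
      have := h₄ c₁
      have := add_mul σ.1.1 1 n
      simp only
      omega
    · refine ⟨hn, c₁, by simp only [pow_succ]; omega, fun _ => ?_⟩
      have := h₄ c₁
      have := add_mul σ.1.1 1 n
      simp only
      omega
    · exact ⟨h₁, h₂, h₃, fun h => absurd h c₁⟩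

theorem searchState_finished {A : Type} {L n T : ℕ} (hL : 1 ≤ L) (hn : 1 ≤ n) (hT : L * n ≤ T)
    (ε : ℝ) (h : History A T) : (searchState L n ε T h).1.1 + 1 = L := by
  obtain ⟨h₁, h₂, -, h₄⟩ := searchState_invariant hL hn ε T h
  by_contra hne
  have := h₄ (by omega)
  have : ((searchState L n ε T h).1.1 + 1) * n ≤ L * n := Nat.mul_le_mul_right _ h₂
  rw [add_mul] at this
  omega

theorem measurable_toNode_searchState {L : ℕ} {S : Type*} [MeasurableSpace S] (n : ℕ) (ε : ℝ)
    (t : ℕ) (g : ℕ × ℕ × ℕ → TreeNode L) :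
    Measurable fun x : S × History (TreeNode L) t => g (searchState L n ε t x.2).1 :=
  (Measurable.of_discrete (f := g)).comp
    ((measurable_searchState L n ε t).comp measurable_snd).fst

/-- The search as a learning algorithm. -/
noncomputable def treeSearch {L : ℕ} (hL : 1 ≤ L) (n : ℕ) (ε : ℝ) (T : ℕ) :
    LearningAlgorithm.{u} (TreeNode L) T where
  Seed := PUnit
  seedLaw := Measure.dirac PUnit.unit
  policy t := Kernel.deterministic
    -- Once a leaf is reached there is no child: `toNode` returns the root, and `searchStep` ignores
    -- the reward.
    (fun x => toNode hL ((searchState L n ε t x.2).1.1 + 1) (2 * (searchState L n ε t x.2).1.2.2))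
    (measurable_toNode_searchState n ε t fun y => toNode hL (y.1 + 1) (2 * y.2.2))
  finalPolicy := Kernel.deterministic
    (fun x => toNode hL (searchState L n ε T x.2).1.1 (searchState L n ε T x.2).1.2.2)
    (measurable_toNode_searchState n ε T fun y => toNode hL y.1 y.2.2)

/-! ### Error analysis by a supermartingale -/

/-- The Chernoff exponent for the test of the left child of node `p.pos l` of level `l`. -/
noncomputable def searchExponent {L : ℕ} (ε : ℝ) (p : TreePath L) (l : ℕ) : ℝ :=
  -- The sign makes the exponential at least `1` whenever the test errs; the size `5 ε` minimises
  -- `-5 ε s + s ^ 2 / 2`.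
  if p.pos (l + 1) = 2 * p.pos l then -(5 * ε) else 5 * ε

/-- An upper bound for the probability that the search misses the leaf of the path `p`. -/
noncomputable def searchPotential {L : ℕ} (n : ℕ) (ε q : ℝ) (p : TreePath L)
    (σ : SearchState) : ℝ :=
  if σ.1.2.2 = p.pos σ.1.1 then
    -- The first term pays `q ^ n` for each later test; the second is the Chernoff bound for the
    -- current one, with `n - k` samples outstanding.
    if σ.1.1 + 1 < L then ((L - 2 - σ.1.1 : ℕ) : ℝ) * q ^ n +
      q ^ (n - σ.1.2.1) * Real.exp (searchExponent ε p σ.1.1 * σ.2)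
    else 0
  else 1

theorem measurable_searchPotential {L : ℕ} (n : ℕ) (ε q : ℝ) (p : TreePath L) :
    Measurable (searchPotential n ε q p) := by
  refine measurable_from_prod_countable_right fun y => ?_
  simp only [searchPotential]
  split_ifs <;> fun_prop

/-- Errors are absorbing: no descendant of a node off the path is on the path. -/
theorem searchPotential_step_of_ne {L n : ℕ} {ε q : ℝ} {p : TreePath L} {σ : SearchState}
    (h : σ.1.2.2 ≠ p.pos σ.1.1) (r : ℝ) : searchPotential n ε q p (searchStep L n ε σ r) = 1 := by
  refine if_neg ?_
  unfold searchStep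
  split_ifs with c₁ c₂ c₃
  · exact h
  · have := p.pos_succ c₁
    simp only
    omega
  · have := p.pos_succ c₁
    simp only
    omega
  · exact h

/-- Only the last sample of a level needs an argument. A right decision starts the next test, whose
`q ^ n` was already counted; a wrong one has potential `1`, which the exponential dominates. -/
theorem searchPotential_step_le {L n : ℕ} {ε q : ℝ} (hε : 0 < ε) (hq : 0 ≤ q) {p : TreePath L}
    {σ : SearchState} (h : σ.1.2.2 = p.pos σ.1.1) (hl : σ.1.1 + 1 < L) (r : ℝ) :
    searchPotential n ε q p (searchStep L n ε σ r) ≤ ((L - 2 - σ.1.1 : ℕ) : ℝ) * q ^ n +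
      q ^ (n - σ.1.2.1 - 1) * Real.exp (searchExponent ε p σ.1.1 * σ.2) *
        Real.exp (searchExponent ε p σ.1.1 * (r - (1 - 7 * ε))) := by
  rw [mul_assoc, ← Real.exp_add, ← mul_add]
  have correct : searchPotential n ε q p ((σ.1.1 + 1, 0, p.pos (σ.1.1 + 1)), 0) ≤
      ((L - 2 - σ.1.1 : ℕ) : ℝ) * q ^ n := by
    simp only [searchPotential, if_true, mul_zero, Real.exp_zero, Nat.sub_zero, mul_one]
    split_ifs with hl'
    · rw [show L - 2 - σ.1.1 = (L - 2 - (σ.1.1 + 1)) + 1 by omega]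
      push_cast
      linarith
    · positivity
  have wrong : ∀ j, j ≠ p.pos (σ.1.1 + 1) →
      searchPotential n ε q p ((σ.1.1 + 1, 0, j), 0) = 1 := fun j hj => if_neg hj
  by_cases c₂ : σ.1.2.1 + 1 < n
  · simp only [searchStep, hl, c₂, if_true]
    rw [searchPotential, if_pos h, if_pos hl]
    exact le_of_eq rfl
  have hk : n - σ.1.2.1 - 1 = 0 := by omega
  rw [hk, pow_zero, one_mul]
  have hcount : 0 ≤ ((L - 2 - σ.1.1 : ℕ) : ℝ) * q ^ n := by positivity
  by_cases c₃ : 0 < σ.2 + (r - (1 - 7 * ε))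
  · simp only [searchStep, hl, c₂, c₃, if_true, if_false]
    by_cases hleft : p.pos (σ.1.1 + 1) = 2 * p.pos σ.1.1
    · rw [h, ← hleft]
      exact correct.trans (le_add_of_nonneg_right (Real.exp_nonneg _))
    · rw [wrong _ (by rw [h]; exact fun e => hleft e.symm), searchExponent, if_neg hleft]
      have := Real.one_le_exp (show 0 ≤ 5 * ε * (σ.2 + (r - (1 - 7 * ε))) by positivity)
      linarith
  · simp only [searchStep, hl, c₂, c₃, if_true, if_false]
    by_cases hleft : p.pos (σ.1.1 + 1) = 2 * p.pos σ.1.1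
    · rw [wrong _ (by rw [h, hleft]; omega), searchExponent, if_pos hleft]
      have := Real.one_le_exp (show 0 ≤ -(5 * ε) * (σ.2 + (r - (1 - 7 * ε))) by
        nlinarith [not_lt.1 c₃])
      linarith
    · rw [h, ← (p.pos_succ hl).resolve_left hleft]
      exact correct.trans (le_add_of_nonneg_right (Real.exp_nonneg _))

/-- The mean is at least `5 ε` from the threshold on the correct side, so the linear term is at most
`-25 ε ^ 2`, and the quadratic one gives half of it back. -/
theorem searchExponent_mul_le {L : ℕ} (hL : 1 ≤ L) {ε : ℝ} (hε : 0 < ε) (p : TreePath L)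
    {l : ℕ} (hl : l + 1 < L) :
    searchExponent ε p l * (treeFun ε p (toNode hL (l + 1) (2 * p.pos l)) - (1 - 7 * ε)) +
      searchExponent ε p l ^ 2 / 2 ≤ -(25 * ε ^ 2 / 2) := by
  have hpos : 2 * p.pos l < 2 ^ (l + 1) := by
    have := p.pos_lt (show l < L by omega)
    rw [pow_succ]
    omega
  have hmem := mem_toNode hL p hl hpos
  by_cases hleft : p.pos (l + 1) = 2 * p.pos l
  · have hf : 1 - 2 * ε ≤ treeFun ε p (toNode hL (l + 1) (2 * p.pos l)) := by
      rw [treeFun, if_pos (hmem.2 hleft.symm)]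
      split_ifs <;> linarith
    rw [searchExponent, if_pos hleft]
    nlinarith
  · rw [treeFun, if_neg (fun hm => hleft (hmem.1 hm).symm), searchExponent, if_neg hleft]
    nlinarith

/-- The potential of the search is a supermartingale. -/
theorem lintegral_searchPotential_step_le {L : ℕ} (hL : 1 ≤ L) (n : ℕ) {ε : ℝ} (hε : 0 < ε)
    (p : TreePath L) (σ : SearchState) :
    ∫⁻ r, ENNReal.ofReal (searchPotential n ε (Real.exp (-(25 * ε ^ 2 / 2))) p
        (searchStep L n ε σ r))
      ∂gaussianReal (treeFun ε p (toNode hL (σ.1.1 + 1) (2 * σ.1.2.2))) 1 ≤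
    ENNReal.ofReal (searchPotential n ε (Real.exp (-(25 * ε ^ 2 / 2))) p σ) := by
  set q := Real.exp (-(25 * ε ^ 2 / 2)) with hq
  have hq₀ : 0 ≤ q := Real.exp_nonneg _
  have hq₁ : q ≤ 1 := Real.exp_le_one_iff.2 (by nlinarith [sq_nonneg ε])
  by_cases h : σ.1.2.2 = p.pos σ.1.1
  swap
  · simp_rw [searchPotential_step_of_ne h]
    simp [searchPotential, h]
  by_cases hl : σ.1.1 + 1 < L
  swap
  · simp [searchStep, hl]
  refine (lintegral_mono fun r => ENNReal.ofReal_le_ofReal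
    (searchPotential_step_le hε hq₀ h hl r)).trans ?_
  have hsplit : ∀ r : ℝ, ENNReal.ofReal (((L - 2 - σ.1.1 : ℕ) : ℝ) * q ^ n +
      q ^ (n - σ.1.2.1 - 1) * Real.exp (searchExponent ε p σ.1.1 * σ.2) *
        Real.exp (searchExponent ε p σ.1.1 * (r - (1 - 7 * ε)))) =
      ENNReal.ofReal (((L - 2 - σ.1.1 : ℕ) : ℝ) * q ^ n) +
      ENNReal.ofReal (q ^ (n - σ.1.2.1 - 1) * Real.exp (searchExponent ε p σ.1.1 * σ.2)) *
        ENNReal.ofReal (Real.exp (searchExponent ε p σ.1.1 * (r - (1 - 7 * ε)))) := fun r => by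
    rw [ENNReal.ofReal_add (by positivity) (by positivity), ← ENNReal.ofReal_mul (by positivity)]
  simp_rw [hsplit]
  rw [lintegral_add_left measurable_const, lintegral_const, measure_univ, mul_one,
    lintegral_const_mul' _ _ ENNReal.ofReal_ne_top, lintegral_exp_gaussianReal,
    ← ENNReal.ofReal_mul (by positivity), ← ENNReal.ofReal_add (by positivity) (by positivity)]
  refine ENNReal.ofReal_le_ofReal ?_
  rw [searchPotential, if_pos h, if_pos hl]
  refine add_le_add le_rfl ?_
  have hexp := Real.exp_le_exp.2 (searchExponent_mul_le hL hε p hl)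
  rw [← hq, ← h] at hexp
  calc _ ≤ q ^ (n - σ.1.2.1 - 1) * Real.exp (searchExponent ε p σ.1.1 * σ.2) * q := by gcongr
    _ = q ^ (n - σ.1.2.1 - 1 + 1) * Real.exp (searchExponent ε p σ.1.1 * σ.2) := by ring
    -- Subtraction is truncated, so the exponents are only known to satisfy `n - k ≤ n - k - 1 + 1`;
    -- `q ≤ 1` then suffices.
    _ ≤ _ := by
      gcongr ?_ * _
      exact pow_le_pow_of_le_one hq₀ hq₁ (by omega)

theorem lintegral_searchPotential_le {L : ℕ} (hL : 1 ≤ L) (n : ℕ) {ε : ℝ} (hε : 0 < ε)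
    (p : TreePath L) (T t : ℕ) :
    ∫⁻ x, ENNReal.ofReal (searchPotential n ε (Real.exp (-(25 * ε ^ 2 / 2))) p
        (searchState L n ε t x.2)) ∂(treeSearch.{u} hL n ε T).dataLaw (treeFun ε p) t ≤
      ENNReal.ofReal (((L - 1 : ℕ) : ℝ) * Real.exp (-(25 * ε ^ 2 / 2)) ^ n) := by
  have hV : ∀ t, Measurable fun x : (treeSearch.{u} hL n ε T).Seed × History (TreeNode L) t =>
      ENNReal.ofReal (searchPotential n ε (Real.exp (-(25 * ε ^ 2 / 2))) p
        (searchState L n ε t x.2)) := fun t =>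
    ((measurable_searchPotential n ε _ p).comp
      ((measurable_searchState L n ε t).comp measurable_snd)).ennreal_ofReal
  induction t with
  | zero =>
    refine (lintegral_mono (g := fun _ => _) fun x => ENNReal.ofReal_le_ofReal ?_).trans
      (by rw [lintegral_const, measure_univ, mul_one])
    simp only [searchState, searchPotential, p.pos_zero, if_true, mul_zero, Real.exp_zero,
      Nat.sub_zero, mul_one]
    split_ifs with h
    · rw [show L - 1 = (L - 2) + 1 by omega]
      push_cast
      linarith
    · positivity
  | succ t ih =>
    refine le_trans ?_ ih
    rw [LearningAlgorithm.lintegral_dataLaw_succ _ _ _ (hV (t + 1))]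
    refine lintegral_mono fun x => ?_
    simp only [searchState_snoc]
    rw [show (treeSearch.{u} hL n ε T).policy t x = Measure.dirac (toNode hL
      ((searchState L n ε t x.2).1.1 + 1) (2 * (searchState L n ε t x.2).1.2.2)) from
        Kernel.deterministic_apply (measurable_toNode_searchState n ε t
          fun y => toNode hL (y.1 + 1) (2 * y.2.2)) x, lintegral_dirac]
    exact lintegral_searchPotential_step_le hL n hε p _

theorem one_sub_le_expectedValue_treeSearch {L : ℕ} (hL : 1 ≤ L) {n T : ℕ} (hn : 1 ≤ n)
    (hT : L * n ≤ T) {ε : ℝ} (hε : 0 < ε)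
    (hq : 12 * (((L - 1 : ℕ) : ℝ) * Real.exp (-(25 * ε ^ 2 / 2)) ^ n) ≤ 1) (p : TreePath L) :
    1 - ε ≤ (treeSearch.{u} hL n ε T).expectedValue (treeFun ε p) := by
  have key := (treeSearch.{u} hL n ε T).lintegral_ofReal_finalPolicy (treeFun ε p) 1 (-1)
    fun a => by linarith [treeFun_le_one hε p a]
  have hle : ENNReal.ofReal (1 + -1 * (treeSearch.{u} hL n ε T).expectedValue (treeFun ε p)) ≤
      ENNReal.ofReal ε := by
    rw [← key]
    -- At the end the potential is the indicator of a miss, and a miss loses at most `12 ε`.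
    calc _ ≤ ∫⁻ x, ENNReal.ofReal (12 * ε) * ENNReal.ofReal (searchPotential n ε
          (Real.exp (-(25 * ε ^ 2 / 2))) p (searchState L n ε T x.2))
          ∂(treeSearch.{u} hL n ε T).dataLaw (treeFun ε p) T := lintegral_mono fun x => ?_
      _ ≤ ENNReal.ofReal (12 * ε) *
          ENNReal.ofReal (((L - 1 : ℕ) : ℝ) * Real.exp (-(25 * ε ^ 2 / 2)) ^ n) := by
        rw [lintegral_const_mul' _ _ ENNReal.ofReal_ne_top]
        gcongr
        exact lintegral_searchPotential_le hL n hε p T T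
      _ ≤ _ := by
        rw [← ENNReal.ofReal_mul (by positivity)]
        refine ENNReal.ofReal_le_ofReal ?_
        nlinarith
    rw [show (treeSearch.{u} hL n ε T).finalPolicy x = Measure.dirac (toNode hL
      (searchState L n ε T x.2).1.1 (searchState L n ε T x.2).1.2.2) from
        Kernel.deterministic_apply (measurable_toNode_searchState n ε T
          fun y => toNode hL y.1 y.2.2) x, lintegral_dirac, ← ENNReal.ofReal_mul (by positivity)]
    refine ENNReal.ofReal_le_ofReal ?_
    have hfin := searchState_finished hL hn hT ε x.2
    obtain ⟨-, hlt, hi, -⟩ := searchState_invariant hL hn ε T x.2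
    generalize searchState L n ε T x.2 = σ at *
    by_cases h : σ.1.2.2 = p.pos σ.1.1
    · rw [treeFun, if_pos ((mem_toNode hL p hlt hi).2 h), if_pos (isLeaf_toNode hL hfin hi),
        searchPotential, if_pos h, if_neg (by omega)]
      norm_num
    · rw [searchPotential, if_neg h]
      linarith [one_sub_le_treeFun hε p (toNode hL σ.1.1 σ.1.2.2)]
  rw [ENNReal.ofReal_le_ofReal_iff hε.le] at hle
  linarith

/-! ### Choice of the sample size and conclusion -/

/-- Takes `n = T / L`. Since a constant failure probability is enough, `log (2 L / ε)` is weakened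
to `log (2 L)`. -/
theorem exists_sample_size {L : ℕ} (hL : 1 ≤ L) {ε : ℝ} (hε : 0 < ε) (hε₁ : ε ≤ 1) {T : ℕ}
    (hT : 2 * (L : ℝ) * Real.log (2 * (L : ℝ) / ε) / ε ^ 2 ≤ (T : ℝ)) :
    ∃ n : ℕ, 1 ≤ n ∧ L * n ≤ T ∧
      12 * (((L - 1 : ℕ) : ℝ) * Real.exp (-(25 * ε ^ 2 / 2)) ^ n) ≤ 1 := by
  have hL' : (1 : ℝ) ≤ L := by exact_mod_cast hL
  have hlog : Real.log (2 * L) ≤ Real.log (2 * L / ε) :=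
    Real.log_le_log (by positivity) (by rw [le_div_iff₀ hε]; nlinarith)
  have hlog₂ : 0.69 ≤ Real.log (2 * L) :=
    (by linarith [Real.log_two_gt_d9] : (0.69 : ℝ) ≤ Real.log 2).trans
      (Real.log_le_log (by norm_num) (by linarith))
  have hlt : (T : ℝ) < L * ((T / L : ℕ) + 1) := by
    exact_mod_cast Nat.lt_mul_div_succ T (by omega)
  have hsq : ε ^ 2 ≤ 1 := by nlinarith
  -- Rounding `T / L` down loses less than one sample, worth `ε ^ 2 ≤ 1`.
  have hn : 2 * Real.log (2 * L) - 1 < (T / L : ℕ) * ε ^ 2 := by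
    rw [div_le_iff₀ (by positivity)] at hT
    have : (L : ℝ) * (2 * Real.log (2 * L / ε)) < L * (((T / L : ℕ) + 1) * ε ^ 2) := by
      calc _ = 2 * (L : ℝ) * Real.log (2 * (L : ℝ) / ε) := by ring
        _ ≤ T * ε ^ 2 := hT
        _ < L * ((T / L : ℕ) + 1) * ε ^ 2 := by gcongr
        _ = _ := by ring
    have := lt_of_mul_lt_mul_left this (by positivity)
    linarith
  refine ⟨T / L, ?_, Nat.mul_div_le T L, ?_⟩
  · by_contra h0
    rw [Nat.lt_one_iff.1 (not_le.1 h0)] at hn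
    norm_num at hn
    linarith
  -- For `L = 1` there is no test and the factor `L - 1` vanishes; `L ≥ 2` gives the larger
  -- logarithm that absorbs the `-1` and `log 6`.
  · rcases eq_or_lt_of_le hL with rfl | hL₂
    · simp
    have hL₂' : (2 : ℝ) ≤ L := by exact_mod_cast hL₂
    have hlog₄ : 1.38 ≤ Real.log (2 * L) := by
      refine le_trans ?_ (Real.log_le_log (by norm_num : (0 : ℝ) < 2 ^ 2) (by linarith))
      rw [Real.log_pow]
      norm_num
      linarith [Real.log_two_gt_d9]
    have hlog₆ : Real.log 6 ≤ 3 := by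
      refine (Real.log_le_log (by norm_num) (by norm_num : (6 : ℝ) ≤ 2 ^ 3)).trans ?_
      rw [Real.log_pow]
      norm_num
      linarith [Real.log_two_lt_d9]
    rw [← Real.exp_nat_mul]
    have hexp : Real.exp ((T / L : ℕ) * -(25 * ε ^ 2 / 2)) ≤ (6 * (2 * (L : ℝ)))⁻¹ := by
      rw [← Real.log_le_log_iff (Real.exp_pos _) (by positivity), Real.log_exp, Real.log_inv,
        Real.log_mul (by norm_num) (by positivity)]
      linarith
    calc _ ≤ 12 * ((L : ℝ) * (6 * (2 * (L : ℝ)))⁻¹) := by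
          gcongr
          omega
      _ = 1 := by field_simp; norm_num

theorem theorem3 (L : ℕ) (hL : 1 ≤ L) (ε : ℝ) (hε : 0 < ε) (T : ℕ) :
    (2 ≤ L → (T : ℝ) ≤ (2 : ℝ) ^ ((L : ℤ) - 5) / (9 * ε ^ 2) →
      ∀ alg : LearningAlgorithm.{u} (TreeNode L) T, alg.IsPlanning →
        ∃ f ∈ treeClass L ε, alg.expectedValue f < (⨆ a, f a) - ε) ∧
    (ε ≤ 1 → 2 * (L : ℝ) * Real.log (2 * (L : ℝ) / ε) / ε ^ 2 ≤ (T : ℝ) →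
      ∃ alg : LearningAlgorithm.{u} (TreeNode L) T,
        ∀ f ∈ treeClass L ε, (⨆ a, f a) - ε ≤ alg.expectedValue f) := by
  refine ⟨fun hL₂ hT alg hp => ?_, fun hε₁ hT => ?_⟩
  · obtain ⟨p, h⟩ := hp.exists_expectedValue_lt hL₂ hε hT alg
    exact ⟨_, ⟨p, rfl⟩, by rwa [iSup_treeFun hL hε]⟩
  · obtain ⟨n, hn, hnT, hq⟩ := exists_sample_size hL hε hε₁ hT
    refine ⟨treeSearch hL n ε T, ?_⟩
    rintro _ ⟨p, rfl⟩
    rw [iSup_treeFun hL hε]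
    exact one_sub_le_expectedValue_treeSearch hL hn hnT hε hq p
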